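/- A \emph{formula} $f$ is a finite non-empty set of non-empty words (its \emph{fragments}, written separated by dots) over an alphabet $\{A,B,C,\dots\}$ of variables. An \emph{occurrence} of $f$ in a word $w$ is a non-erasing morphism $h$ (the image of every variable is a non-empty word) such that the $h$-image of every fragment of $f$ is a factor of $w$; the word $w$ \emph{avoids} $f$ if $f$ has no occurrence in $w$. For formulas $f,g$, write $f\preceq g$ if $g$ is divisible by $f$, i.e., there is a non-erasing morphism $h$ such that the $h$-image of every fragment of $f$ is a factor of some fragment of $g$. A (right) infinite word is \emph{recurrent} if each of its finite factors appears in it infinitely many times, and two infinite words are \emph{equivalent} if they have the same set of finite factors. Let $b_2$ be the Thue--Morse word, i.e., the fixed point starting with $0$ of the morphism $0\mapsto 01$, $1\mapsto 10$. \textbf{Theorem.} Let $f$ be any formula with $AABCAA.BCB\preceq f\preceq AABCAAB.AABCAB.AABCB$. Then every infinite recurrent word over $\{0,1\}$ that avoids $f$ is equivalent to $b_2$. -/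

import Mathlib

namespace FormulaAvoidance

/-- The image of a finite word under the morphism of free monoids that sends each letter `x` to
the word `h x`. -/
def applyMorphism {α β : Type*} (h : α → List β) (u : List α) : List β := u.flatMap h

/-- A morphism is non-erasing if the image of every letter is non-empty. -/
def NonErasing {α β : Type*} (h : α → List β) : Prop := ∀ x, h x ≠ []

/-- The finite word `u` appears in the (right) infinite word `w` at position `i`. -/
def AppearsAt {α : Type*} (u : List α) (w : ℕ → α) (i : ℕ) : Prop :=
  u = (List.range u.length).map fun j => w (i + j)

/-- The finite word `u` is a factor of the infinite word `w`. -/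
def IsFactor {α : Type*} (u : List α) (w : ℕ → α) : Prop := ∃ i, AppearsAt u w i

/-- An infinite word is recurrent if each of its finite factors appears infinitely many times. -/
def Recurrent {α : Type*} (w : ℕ → α) : Prop :=
  ∀ u, IsFactor u w → {i | AppearsAt u w i}.Infinite

/-- Two infinite words are equivalent if they have the same set of (finite) factors. -/
def Equivalent {α : Type*} (w w' : ℕ → α) : Prop := {u | IsFactor u w} = {u | IsFactor u w'}

/-- A formula: a finite non-empty set of fragments, each a non-empty word over the countable
alphabet `ℕ` of variables. -/
structure Formula where
  fragments : Finset (List ℕ)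
  nonempty : fragments.Nonempty
  fragment_ne_nil : ∀ φ ∈ fragments, φ ≠ []

/-- The morphism `h` is an occurrence of the formula `f` in the infinite word `w`: it is
non-erasing and maps every fragment of `f` to a factor of `w`. -/
def IsOccurrence {α : Type*} (h : ℕ → List α) (f : Formula) (w : ℕ → α) : Prop :=
  NonErasing h ∧ ∀ φ ∈ f.fragments, IsFactor (applyMorphism h φ) w

/-- The infinite word `w` avoids the formula `f`. -/
def Avoids {α : Type*} (w : ℕ → α) (f : Formula) : Prop :=
  ¬ ∃ h : ℕ → List α, IsOccurrence h f w

/-- `f ⪯ g`: the formula `g` is divisible by `f`, that is, some non-erasing morphism maps every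
fragment of `f` to a factor of a fragment of `g`. -/
def Divides (f g : Formula) : Prop :=
  ∃ h : ℕ → List ℕ, NonErasing h ∧
    ∀ φ ∈ f.fragments, ∃ ψ ∈ g.fragments, applyMorphism h φ <:+: ψ

/-- The variable `A`. -/
abbrev A : ℕ := 0
/-- The variable `B`. -/
abbrev B : ℕ := 1
/-- The variable `C`. -/
abbrev C : ℕ := 2

/-- The formula `AABCAA.BCB`. -/
def lowerFormula : Formula where
  fragments := {[A, A, B, C, A, A], [B, C, B]}
  nonempty := by simp
  fragment_ne_nil := by simp

/-- The formula `AABCAAB.AABCAB.AABCB`. -/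
def upperFormula : Formula where
  fragments := {[A, A, B, C, A, A, B], [A, A, B, C, A, B], [A, A, B, C, B]}
  nonempty := by simp
  fragment_ne_nil := by simp

/-- The Thue–Morse morphism `0 ↦ 01`, `1 ↦ 10`. -/
def thueMorseMorphism : Fin 2 → List (Fin 2) := ![[0, 1], [1, 0]]

/-- The `n`-th iterate of the Thue–Morse morphism on the letter `0`, a word of length `2 ^ n`. -/
def thueMorsePrefix (n : ℕ) : List (Fin 2) := (applyMorphism thueMorseMorphism)^[n] [0]

/-- The Thue–Morse word `b₂`, the fixed point starting with `0` of the Thue–Morse morphism: the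
right infinite word having all `thueMorsePrefix n` as prefixes. Since `n < 2 ^ n`, the default
value of `getD` is never used. -/
def thueMorse (n : ℕ) : Fin 2 := (thueMorsePrefix n).getD n 0

theorem length_thueMorsePrefix (n : ℕ) : (thueMorsePrefix n).length = 2 ^ n := by
  have key : ∀ u : List (Fin 2),
      (applyMorphism thueMorseMorphism u).length = 2 * u.length := by
    intro u
    induction u with
    | nil => rfl
    | cons a u ih =>
      have ha : (thueMorseMorphism a).length = 2 := by fin_cases a <;> rfl
      simp only [applyMorphism, List.flatMap_cons, List.length_append, List.length_cons] at ih ⊢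
      omega
  induction n with
  | zero => rfl
  | succ n ih =>
    rw [thueMorsePrefix, Function.iterate_succ_apply', key]
    rw [thueMorsePrefix] at ih
    rw [ih, pow_succ, mul_comm]

theorem thueMorsePrefix_isPrefix {m n : ℕ} (h : m ≤ n) :
    thueMorsePrefix m <+: thueMorsePrefix n := by
  have step : ∀ k, thueMorsePrefix k <+: thueMorsePrefix (k + 1) := by
    intro k
    induction k with
    | zero => exact ⟨[1], rfl⟩
    | succ k ih =>
      obtain ⟨t, ht⟩ := ih
      refine ⟨applyMorphism thueMorseMorphism t, ?_⟩
      have e : ∀ j, thueMorsePrefix (j + 1)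
          = applyMorphism thueMorseMorphism (thueMorsePrefix j) :=
        fun j => Function.iterate_succ_apply' _ _ _
      calc thueMorsePrefix (k + 1) ++ applyMorphism thueMorseMorphism t
          = applyMorphism thueMorseMorphism (thueMorsePrefix k ++ t) := by
            rw [e k]; simp [applyMorphism]
        _ = thueMorsePrefix (k + 1 + 1) := by rw [ht, e (k + 1)]
  induction n, h using Nat.le_induction with
  | base => exact List.prefix_rfl
  | succ n _ ih => exact ih.trans (step n)

/-- All words `thueMorsePrefix n` are prefixes of `thueMorse`. -/
theorem appearsAt_thueMorsePrefix (n : ℕ) : AppearsAt (thueMorsePrefix n) thueMorse 0 := by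
  refine List.ext_getElem (by simp) fun i h₁ h₂ => ?_
  have hi : i < (thueMorsePrefix i).length := by
    rw [length_thueMorsePrefix]; exact Nat.lt_two_pow_self
  simp only [List.getElem_map, List.getElem_range, zero_add, thueMorse,
    List.getD_eq_getElem _ _ hi]
  rcases le_total i n with h | h
  · exact ((thueMorsePrefix_isPrefix h).getElem hi).symm
  · exact (thueMorsePrefix_isPrefix h).getElem h₁

end FormulaAvoidance

namespace FormulaAvoidance

/-! Avoidance passes to divisible formulas, so `w` avoids `upperFormula`. An overlap `axaxa` in `w`
would recur; with `A = ax`, `B = a` and `C` the gap, `w` would contain `AABCAAB`, whose prefixes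
include the other two fragments because `AB` and `B` are prefixes of `AAB`. Hence `w` is
overlap-free.

In a recurrent overlap-free binary word all squares of letters start at positions of one parity.
Cutting every such square in the middle splits a suffix of the word into blocks `01` and `10`, so
that suffix is the Thue–Morse image of a word that is again recurrent and overlap-free. Iterating
gives blocks of length `2 ^ n`, each a Thue–Morse prefix or its complement, and the factors can be
compared block by block. -/

/-- The factor of length `n` of the infinite word `w` at position `i`. -/
def slice {α : Type*} (w : ℕ → α) (i n : ℕ) : List α := (List.range n).map fun j => w (i + j)

@[simp] theorem length_slice {α : Type*} (w : ℕ → α) (i n : ℕ) : (slice w i n).length = n := by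
  simp [slice]

theorem slice_add {α : Type*} (w : ℕ → α) (i m n : ℕ) :
    slice w i (m + n) = slice w i m ++ slice w (i + m) n := by
  simp [slice, List.range_add, Function.comp_def, add_assoc]

theorem slice_eq_slice {α : Type*} {w v : ℕ → α} {i j n : ℕ} :
    slice w i n = slice v j n ↔ ∀ k < n, w (i + k) = v (j + k) := by
  simp [slice]

theorem isFactor_iff {α : Type*} {u : List α} {w : ℕ → α} :
    IsFactor u w ↔ ∃ i n, u = slice w i n := by
  constructor
  · rintro ⟨i, hi⟩
    exact ⟨i, u.length, hi⟩
  · rintro ⟨i, n, rfl⟩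
    exact ⟨i, by simp [AppearsAt, slice]⟩

theorem isFactor_slice {α : Type*} (w : ℕ → α) (i n : ℕ) : IsFactor (slice w i n) w :=
  isFactor_iff.2 ⟨i, n, rfl⟩

theorem IsFactor.of_infix {α : Type*} {u v : List α} {w : ℕ → α} (hv : IsFactor v w)
    (h : u <:+: v) : IsFactor u w := by
  obtain ⟨i, n, rfl⟩ := isFactor_iff.1 hv
  obtain ⟨s, t, hst⟩ := h
  have hn : n = s.length + (u.length + t.length) := by
    have := congrArg List.length hst
    simp at this
    omega
  rw [hn, slice_add, slice_add, List.append_assoc] at hst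
  have h1 := (List.append_inj hst (by simp)).2
  rw [(List.append_inj h1 (by simp)).1]
  exact isFactor_slice _ _ _

theorem applyMorphism_comp {α β γ : Type*} (g : β → List γ) (h : α → List β) (u : List α) :
    applyMorphism (fun x => applyMorphism g (h x)) u = applyMorphism g (applyMorphism h u) := by
  simp [applyMorphism, List.flatMap_assoc]

theorem applyMorphism_infix {α β : Type*} (h : α → List β) {u v : List α} (huv : u <:+: v) :
    applyMorphism h u <:+: applyMorphism h v := by
  obtain ⟨s, t, rfl⟩ := huv
  exact ⟨applyMorphism h s, applyMorphism h t, by simp [applyMorphism]⟩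

theorem NonErasing.comp {α β γ : Type*} {g : β → List γ} {h : α → List β} (hg : NonErasing g)
    (hh : NonErasing h) : NonErasing fun x => applyMorphism g (h x) := by
  intro x hx
  obtain ⟨y, hy⟩ := List.exists_mem_of_ne_nil _ (hh x)
  exact hg y (List.flatMap_eq_nil_iff.1 hx y hy)

/-- Avoidance is inherited by divisible formulas. -/
theorem Avoids.of_divides {α : Type*} {f g : Formula} {w : ℕ → α} (hf : Avoids w f)
    (hfg : Divides f g) : Avoids w g := by
  rintro ⟨k, hk, hkg⟩
  obtain ⟨h, hh, hfr⟩ := hfg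
  refine hf ⟨fun x => applyMorphism k (h x), hk.comp hh, fun φ hφ => ?_⟩
  obtain ⟨ψ, hψ, hi⟩ := hfr φ hφ
  rw [applyMorphism_comp]
  exact (hkg ψ hψ).of_infix (applyMorphism_infix k hi)

/-- Every factor of a recurrent word appears arbitrarily far. -/
theorem Recurrent.exists_ge {α : Type*} {w : ℕ → α} (hw : Recurrent w) (i n N : ℕ) :
    ∃ j ≥ N, ∀ k < n, w (j + k) = w (i + k) := by
  obtain ⟨j, hj, hN⟩ := (hw _ (isFactor_slice w i n)).exists_gt N
  refine ⟨j, hN.le, slice_eq_slice.1 ?_⟩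
  have : slice w i n = slice w j (slice w i n).length := hj
  rw [length_slice] at this
  exact this.symm

theorem recurrent_of_exists_ge {α : Type*} {w : ℕ → α}
    (hw : ∀ i n N, ∃ j ≥ N, ∀ k < n, w (j + k) = w (i + k)) : Recurrent w := by
  intro u hu
  obtain ⟨i, n, rfl⟩ := isFactor_iff.1 hu
  refine Set.infinite_of_not_bddAbove ?_
  rintro ⟨N, hN⟩
  obtain ⟨j, hj, hjk⟩ := hw i n (N + 1)
  have : j ≤ N := hN (by
    change slice w i n = slice w j (slice w i n).length
    rw [length_slice]
    exact (slice_eq_slice.2 hjk).symm)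
  omega

/-! ### From avoidance to overlap-freeness -/

/-- An infinite word is overlap-free if it has no factor of the form `axaxa`, with `a` a letter. -/
def OverlapFree {α : Type*} (w : ℕ → α) : Prop :=
  ∀ i n, 0 < n → ∃ k ≤ n, w (i + k) ≠ w (i + k + n)

/-- If `AAB` is an overlap that recurs as `AABCAAB`, then `AABCAB` and `AABCB` are prefixes of
`AABCAAB`. -/
theorem overlapFree_of_avoids_upperFormula {α : Type*} {w : ℕ → α} (hrec : Recurrent w)
    (hw : Avoids w upperFormula) : OverlapFree w := by
  intro i n hn
  by_contra! hov
  -- The copy starts at least one letter after the overlap ends, so that `C` is non-empty.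
  obtain ⟨j, hj, hjk⟩ := hrec.exists_ge i (n + n + 1) (i + (n + n + 1) + 1)
  obtain ⟨d, rfl⟩ := Nat.exists_eq_add_of_le hj
  set a := slice w i n with ha
  set b := slice w i 1 with hb
  set c := slice w (i + (n + n + 1)) (1 + d) with hc
  set j := i + (n + n + 1) + 1 + d with hj'
  have haab : slice w i (n + n + 1) = a ++ a ++ b := by
    rw [slice_add, slice_add]
    congr 1
    · congr 1
      refine slice_eq_slice.2 fun k hk => ?_
      rw [hov k hk.le]
      congr 1; omega
    · refine slice_eq_slice.2 fun k hk => ?_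
      have h0 := hov 0 (by omega)
      have h1 := hov n le_rfl
      obtain rfl : k = 0 := by omega
      simp only [add_zero] at h0 ⊢
      rw [h0, h1]
      congr 1; omega
  have hab : slice w i (n + 1) = a ++ b := by
    rw [slice_add]
    congr 1
    refine slice_eq_slice.2 fun k hk => ?_
    have h0 := hov 0 (by omega)
    obtain rfl : k = 0 := by omega
    simpa using h0.symm
  have key : ∀ m ≤ n + n + 1,
      slice w i (n + n + 1 + (1 + d) + m) = a ++ a ++ b ++ c ++ slice w i m := by
    intro m hm
    rw [slice_add, slice_add, haab]
    congr 1
    refine slice_eq_slice.2 fun k hk => ?_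
    rw [← hjk k (by omega), hj']
    congr 1; omega
  refine hw ⟨fun x => if x = 0 then a else if x = 1 then b else c, fun x => ?_, fun φ hφ => ?_⟩
  · dsimp only
    split_ifs <;> rw [← List.length_pos_iff_ne_nil] <;> simp [ha, hb, hc, hn]
  · simp only [upperFormula, Finset.mem_insert, Finset.mem_singleton] at hφ
    rcases hφ with rfl | rfl | rfl
    · convert isFactor_slice w i (n + n + 1 + (1 + d) + (n + n + 1)) using 1
      rw [key _ le_rfl, haab]
      simp [applyMorphism, A, B, C]
    · convert isFactor_slice w i (n + n + 1 + (1 + d) + (n + 1)) using 1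
      rw [key _ (by omega), hab]
      simp [applyMorphism, A, B, C]
    · convert isFactor_slice w i (n + n + 1 + (1 + d) + 1) using 1
      rw [key _ (by omega), ← hb]
      simp [applyMorphism, A, B, C]

/-! ### Squares of letters in overlap-free binary words -/

theorem fin_two_eq_add_one {a b : Fin 2} (h : a ≠ b) : b = a + 1 := by
  revert a b; decide

/-- An overlap-free word has no cube of a letter. -/
theorem OverlapFree.not_cube {α : Type*} {w : ℕ → α} (hw : OverlapFree w) {i : ℕ}
    (h : w i = w (i + 1)) : w (i + 1) ≠ w (i + 2) := by
  intro h'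
  obtain ⟨k, hk, hne⟩ := hw i 1 one_pos
  interval_cases k
  · exact hne h
  · exact hne h'

/-- An overlap-free word has no factor `ababa`. -/
theorem OverlapFree.exists_double {w : ℕ → Fin 2} (hw : OverlapFree w) (i : ℕ) :
    ∃ k < 4, w (i + k) = w (i + k + 1) := by
  by_contra! h
  obtain ⟨k, hk, hne⟩ := hw i 2 two_pos
  have h1 := fin_two_eq_add_one (h k (by omega))
  have h2 := fin_two_eq_add_one (h (k + 1) (by omega))
  apply hne
  rw [show i + k + 2 = i + (k + 1) + 1 by omega, h2, show i + (k + 1) = i + k + 1 by omega, h1]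
  generalize w (i + k) = x
  revert x; decide

/-- In a recurrent overlap-free binary word there is no factor `aabaa`. -/
theorem OverlapFree.not_double_double {w : ℕ → Fin 2} (hw : OverlapFree w) (hrec : Recurrent w)
    {i : ℕ} (h0 : w i = w (i + 1)) : w (i + 3) ≠ w (i + 4) := by
  intro h3
  -- Recurrence supplies a letter to the left. Both neighbours of `aabaa` must be `b`, and `baabaab`
  -- is an overlap of period 3.
  obtain ⟨j, hj, hjk⟩ := hrec.exists_ge i 5 1
  obtain ⟨l, rfl⟩ := Nat.exists_eq_add_of_le' hj
  have e0 := hjk 0 (by omega)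
  have e1 := hjk 1 (by omega)
  have e3 := hjk 3 (by omega)
  have e4 := hjk 4 (by omega)
  have d1 : w (l + 1) = w (l + 1 + 1) := by rw [e1]; simpa [h0] using e0
  have d4 : w (l + 4) = w (l + 4 + 1) := by
    rw [show l + 4 = l + 1 + 3 by omega, show l + 1 + 3 + 1 = l + 1 + 4 by omega, e3, e4, h3]
  have n0 : w l ≠ w (l + 1) := fun h => hw.not_cube h d1
  have n2 := hw.not_cube d1
  have n3 : w (l + 3) ≠ w (l + 4) := fun h => hw.not_cube h d4
  have n5 := hw.not_cube d4
  obtain ⟨k, hk, hne⟩ := hw l 3 (by omega)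
  apply hne
  have key : ∀ a b c d e f g : Fin 2, a ≠ b → b = c → c ≠ d → d ≠ e → e = f → f ≠ g →
      a = d ∧ b = e ∧ c = f ∧ d = g := by decide
  obtain ⟨k0, k1, k2, k3⟩ := key (w l) (w (l + 1)) (w (l + 2)) (w (l + 3)) (w (l + 4)) (w (l + 5))
    (w (l + 6)) n0 d1 n2 n3 d4 n5
  interval_cases k
  · exact k0
  · exact k1
  · exact k2
  · exact k3

/-- In a recurrent overlap-free binary word, all squares of letters appear at positions of the
same parity. -/
theorem OverlapFree.even_of_double {w : ℕ → Fin 2} (hw : OverlapFree w) (hrec : Recurrent w)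
    {i : ℕ} (hi : w i = w (i + 1)) (d : ℕ) (hd : w (i + d) = w (i + d + 1)) : Even d := by
  induction d using Nat.strong_induction_on generalizing i with
  | _ d ih =>
    have n1 := hw.not_cube hi
    have n3 := hw.not_double_double hrec hi
    rcases Nat.lt_or_ge d 4 with h4 | h4
    · interval_cases d
      · simp
      · exact absurd hd n1
      · decide
      · exact absurd hd n3
    · obtain ⟨k, hk, hk'⟩ := hw.exists_double (i + 1)
      have hk2 : k + 1 = 2 ∨ k + 1 = 4 := by
        interval_cases k
        · exact absurd hk' n1
        · simp
        · exact absurd hk' n3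
        · simp
      have := ih (d - (k + 1)) (by omega) (i := i + 1 + k) hk'
        (by rw [show i + 1 + k + (d - (k + 1)) = i + d by omega]; exact hd)
      rcases this with ⟨r, hr⟩
      rcases hk2 with h | h
      · exact ⟨r + 1, by omega⟩
      · exact ⟨r + 2, by omega⟩

/-! ### Desubstitution -/

/-- Up to a prefix, a recurrent overlap-free binary word is the image under the Thue–Morse
morphism of a recurrent overlap-free binary word. -/
theorem OverlapFree.exists_desubstitution {w : ℕ → Fin 2} (hw : OverlapFree w)
    (hrec : Recurrent w) : ∃ p, ∃ v : ℕ → Fin 2, OverlapFree v ∧ Recurrent v ∧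
      ∀ k, w (2 * k + p) = v k ∧ w (2 * k + p + 1) = v k + 1 := by
  obtain ⟨i, -, hi⟩ := hw.exists_double 0
  rw [zero_add] at hi
  have hv : ∀ k, w (2 * k + (i + 1) + 1) = w (2 * k + (i + 1)) + 1 := by
    intro k
    refine fin_two_eq_add_one fun h => ?_
    obtain ⟨r, hr⟩ := hw.even_of_double hrec hi (2 * k + 1)
      (by rw [show i + (2 * k + 1) = 2 * k + (i + 1) by omega]; exact h)
    omega
  refine ⟨i + 1, fun k => w (2 * k + (i + 1)), ?_, ?_, fun k => ⟨rfl, hv k⟩⟩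
  · intro j n hn
    by_contra! h
    obtain ⟨k, hk, hne⟩ := hw (2 * j + (i + 1)) (2 * n) (by omega)
    apply hne
    rcases Nat.even_or_odd' k with ⟨r, rfl | rfl⟩
    · have := h r (by omega)
      rw [show 2 * j + (i + 1) + 2 * r = 2 * (j + r) + (i + 1) by omega, this]
      congr 1; omega
    · have := h r (by omega)
      rw [show 2 * j + (i + 1) + (2 * r + 1) = 2 * (j + r) + (i + 1) + 1 by omega,
        show 2 * (j + r) + (i + 1) + 1 + 2 * n = 2 * (j + r + n) + (i + 1) + 1 by omega, hv, hv, this]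
  · refine recurrent_of_exists_ge fun j n N => ?_
    -- The 5 extra letters ensure that the window contains a square of a letter, which forces its
    -- copy to start at the same parity.
    obtain ⟨l, hl, hlk⟩ := hrec.exists_ge (2 * j + (i + 1)) (2 * n + 5) (2 * N + (i + 1))
    obtain ⟨s, hs, hsd⟩ := hw.exists_double (2 * j + (i + 1))
    obtain ⟨e, rfl⟩ := Nat.exists_eq_add_of_le hl
    have hld : w (2 * N + (i + 1) + e + s) = w (2 * N + (i + 1) + e + s + 1) := by
      rw [hlk s (by omega), hsd, add_assoc _ s 1, add_assoc _ s 1, hlk (s + 1) (by omega)]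
    obtain ⟨r₁, h₁⟩ := hw.even_of_double hrec hi (2 * N + 1 + e + s) (by
      rw [show i + (2 * N + 1 + e + s) = 2 * N + (i + 1) + e + s by omega]; exact hld)
    obtain ⟨r₂, h₂⟩ := hw.even_of_double hrec hi (2 * j + 1 + s) (by
      rw [show i + (2 * j + 1 + s) = 2 * j + (i + 1) + s by omega]; exact hsd)
    obtain ⟨t, rfl⟩ : ∃ t, e = 2 * t := ⟨e / 2, by omega⟩
    refine ⟨N + t, by omega, fun k hk => ?_⟩
    have := hlk (2 * k) (by omega)
    convert this using 2 <;> omega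

/-! ### Block structure and comparison of factors -/

theorem getD_applyMorphism_thueMorseMorphism (u : List (Fin 2)) (k : ℕ) (hk : k < u.length) :
    (applyMorphism thueMorseMorphism u).getD (2 * k) 0 = u.getD k 0 ∧
      (applyMorphism thueMorseMorphism u).getD (2 * k + 1) 0 = u.getD k 0 + 1 := by
  induction u generalizing k with
  | nil => simp at hk
  | cons a u ih =>
    have ha : thueMorseMorphism a = [a, a + 1] := by fin_cases a <;> rfl
    have hcons : applyMorphism thueMorseMorphism (a :: u) =
        a :: (a + 1) :: applyMorphism thueMorseMorphism u := by
      simp [applyMorphism, ha]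
    rw [hcons]
    cases k with
    | zero => simp
    | succ k =>
      have := ih k (by simpa using hk)
      rw [show 2 * (k + 1) = 2 * k + 1 + 1 by omega]
      simpa only [List.getD_cons_succ] using this

theorem thueMorse_eq_getD {n k : ℕ} (hk : k < 2 ^ n) :
    thueMorse k = (thueMorsePrefix n).getD k 0 := by
  have h : thueMorsePrefix n = slice thueMorse 0 (thueMorsePrefix n).length :=
    appearsAt_thueMorsePrefix n
  rw [length_thueMorsePrefix] at h
  rw [h, List.getD_eq_getElem _ _ (by simpa using hk)]
  simp [slice]

theorem thueMorse_two_mul (k : ℕ) :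
    thueMorse (2 * k) = thueMorse k ∧ thueMorse (2 * k + 1) = thueMorse k + 1 := by
  have hk : k < 2 ^ k := Nat.lt_two_pow_self
  have h := getD_applyMorphism_thueMorseMorphism (thueMorsePrefix k) k
    (by rwa [length_thueMorsePrefix])
  have e : applyMorphism thueMorseMorphism (thueMorsePrefix k) = thueMorsePrefix (k + 1) :=
    (Function.iterate_succ_apply' _ _ _).symm
  rw [e, ← thueMorse_eq_getD hk, ← thueMorse_eq_getD (by rw [pow_succ]; omega),
    ← thueMorse_eq_getD (by rw [pow_succ]; omega)] at h
  exact h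

/-- The block of length `2 ^ n` of the Thue–Morse word at position `2 ^ n * k` is the prefix of that
length or its complement. -/
theorem thueMorse_pow_mul_add (n k r : ℕ) (hr : r < 2 ^ n) :
    thueMorse (2 ^ n * k + r) = thueMorse k + thueMorse r := by
  induction n generalizing r with
  | zero =>
    obtain rfl : r = 0 := by simpa using hr
    simp [thueMorse, thueMorsePrefix]
  | succ n ih =>
    have hp : 2 ^ (n + 1) * k = 2 * (2 ^ n * k) := by ring
    rw [pow_succ] at hr
    rcases Nat.even_or_odd' r with ⟨s, rfl | rfl⟩
    · rw [hp, ← mul_add, (thueMorse_two_mul _).1, (thueMorse_two_mul _).1, ih _ (by omega)]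
    · rw [hp, ← add_assoc, ← mul_add, (thueMorse_two_mul _).2, (thueMorse_two_mul _).2,
        ih _ (by omega), add_assoc]

/-- Addition in `Fin 2` encodes complementation: `v k` tells whether the `k`-th block is
complemented. -/
theorem OverlapFree.exists_iterated_desubstitution {w : ℕ → Fin 2} (hw : OverlapFree w)
    (hrec : Recurrent w) (n : ℕ) : ∃ p, ∃ v : ℕ → Fin 2, OverlapFree v ∧
      ∀ k, ∀ r < 2 ^ n, w (2 ^ n * k + p + r) = v k + thueMorse r := by
  induction n generalizing w with
  | zero =>
    refine ⟨0, w, hw, fun k r hr => ?_⟩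
    obtain rfl : r = 0 := by simpa using hr
    simp [thueMorse, thueMorsePrefix]
  | succ n ih =>
    obtain ⟨q, v, hv, hvrec, hqv⟩ := hw.exists_desubstitution hrec
    obtain ⟨p, x, hx, hpx⟩ := ih hv hvrec
    refine ⟨2 * p + q, x, hx, fun k r hr => ?_⟩
    rw [pow_succ] at hr
    have hp : 2 ^ (n + 1) * k = 2 * (2 ^ n * k) := by ring
    rcases Nat.even_or_odd' r with ⟨s, rfl | rfl⟩
    · rw [hp, show 2 * (2 ^ n * k) + (2 * p + q) + 2 * s = 2 * (2 ^ n * k + p + s) + q by omega,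
        (hqv _).1, (thueMorse_two_mul _).1, hpx _ _ (by omega)]
    · rw [hp, show 2 * (2 ^ n * k) + (2 * p + q) + (2 * s + 1) = 2 * (2 ^ n * k + p + s) + q + 1 by
        omega, (hqv _).2, (thueMorse_two_mul _).2, hpx _ _ (by omega), add_assoc]

/-- All words of length two are factors of the Thue–Morse word. -/
theorem exists_thueMorse_pair (a b : Fin 2) : ∃ k, thueMorse k = a ∧ thueMorse (k + 1) = b := by
  -- The prefix is `01101001`, which contains all four pairs.
  have h : ∀ a b : Fin 2, ∃ k < 7, (thueMorsePrefix 3).getD k 0 = a ∧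
      (thueMorsePrefix 3).getD (k + 1) 0 = b := by decide
  obtain ⟨k, hk, h1, h2⟩ := h a b
  exact ⟨k, by rwa [thueMorse_eq_getD (n := 3) (by omega)],
    by rwa [thueMorse_eq_getD (n := 3) (by omega)]⟩

/-- A recurrent overlap-free binary word is equivalent to the Thue–Morse word. -/
theorem OverlapFree.equivalent_thueMorse {w : ℕ → Fin 2} (hw : OverlapFree w)
    (hrec : Recurrent w) : Equivalent w thueMorse := by
  ext u
  simp only [Set.mem_ofPred_eq]
  constructor
  · intro hu
    obtain ⟨i, n, rfl⟩ := isFactor_iff.1 hu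
    -- Since `n < 2 ^ n`, a copy of the factor beyond `p` meets at most two consecutive blocks.
    obtain ⟨p, v, -, hpv⟩ := hw.exists_iterated_desubstitution hrec n
    obtain ⟨j, hj, hjk⟩ := hrec.exists_ge i n p
    have hpos : 0 < 2 ^ n := by positivity
    have hn : n < 2 ^ n := Nat.lt_two_pow_self
    set k := (j - p) / 2 ^ n
    set r := (j - p) % 2 ^ n
    have hr : r < 2 ^ n := Nat.mod_lt _ hpos
    have hjr : j = 2 ^ n * k + p + r := by
      have : 2 ^ n * k + r = j - p := Nat.div_add_mod _ _
      omega
    obtain ⟨K, hK0, hK1⟩ := exists_thueMorse_pair (v k) (v (k + 1))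
    refine isFactor_iff.2 ⟨2 ^ n * K + r, n, slice_eq_slice.2 fun s hs => ?_⟩
    rw [← hjk s hs, hjr]
    rcases Nat.lt_or_ge (r + s) (2 ^ n) with h | h
    · rw [add_assoc _ r s, add_assoc _ r s, hpv _ _ h, thueMorse_pow_mul_add _ _ _ h, hK0]
    · obtain ⟨t, ht⟩ := Nat.exists_eq_add_of_le h
      have hk : 2 ^ n * (k + 1) = 2 ^ n * k + 2 ^ n := by ring
      have hK : 2 ^ n * (K + 1) = 2 ^ n * K + 2 ^ n := by ring
      rw [show 2 ^ n * k + p + r + s = 2 ^ n * (k + 1) + p + t by omega,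
        show 2 ^ n * K + r + s = 2 ^ n * (K + 1) + t by omega, hpv _ _ (by omega),
        thueMorse_pow_mul_add _ _ _ (by omega), hK1]
  · intro hu
    obtain ⟨i, n, rfl⟩ := isFactor_iff.1 hu
    obtain ⟨p, v, hv, hpv⟩ := hw.exists_iterated_desubstitution hrec (i + n)
    have hn : i + n < 2 ^ (i + n) := Nat.lt_two_pow_self
    -- A block with `v k = 0` is a Thue–Morse prefix long enough to contain the factor; without one,
    -- `v` would be constant and contain a cube.
    obtain ⟨k, hk⟩ : ∃ k, v k = 0 := by
      by_contra! h
      have h1 : ∀ k, v k = 1 := fun k => Fin.eq_one_of_ne_zero _ (h k)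
      exact hv.not_cube (i := 0) (by simp [h1]) (by simp [h1])
    refine isFactor_iff.2 ⟨2 ^ (i + n) * k + p + i, n, slice_eq_slice.2 fun s hs => ?_⟩
    rw [add_assoc _ i s, hpv _ _ (by omega), hk, zero_add]

end FormulaAvoidance

theorem mainTheorem7 (f : FormulaAvoidance.Formula)
    (hlower : FormulaAvoidance.Divides FormulaAvoidance.lowerFormula f)
    (hupper : FormulaAvoidance.Divides f FormulaAvoidance.upperFormula)
    (w : ℕ → Fin 2) (hrec : FormulaAvoidance.Recurrent w)
    (havoid : FormulaAvoidance.Avoids w f) :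
    FormulaAvoidance.Equivalent w FormulaAvoidance.thueMorse :=
  (FormulaAvoidance.overlapFree_of_avoids_upperFormula hrec
    (havoid.of_divides hupper)).equivalent_thueMorse hrec
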